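/- Let $d$ be a squarefree integer (positive or negative), and let $E_d$ be the elliptic curve over $\mathbb{Q}$ given by $$E_d:\quad dy^2=x^3-35x-98,$$ with the point at infinity as neutral element. The map $(x,y)\mapsto(dx,d^2y)$ identifies $E_d$ with the Weierstrass model $y^2=x^3-35d^2x-98d^3$. Then the torsion subgroup of $E_d(\mathbb{Q})$ is isomorphic to $\mathbb{Z}/2\mathbb{Z}$, and it is generated by the point which has coordinates $(7d,0)$ on the model $y^2=x^3-35d^2x-98d^3$. -/

import Mathlib

/-- The Weierstrass model `y² = x³ - 35 d² x - 98 d³` over `ℚ` of the quadratic twist `E_d`. -/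
def twistModel (d : ℤ) : WeierstrassCurve.Affine ℚ where
  a₁ := 0
  a₂ := 0
  a₃ := 0
  a₄ := -35 * (d : ℚ) ^ 2
  a₆ := -98 * (d : ℚ) ^ 3

theorem twistModel_equation_iff (d : ℤ) (x y : ℚ) :
    (twistModel d).Equation x y ↔ y ^ 2 = x ^ 3 - 35 * (d : ℚ) ^ 2 * x - 98 * (d : ℚ) ^ 3 := by
  rw [WeierstrassCurve.Affine.equation_iff]
  simp only [twistModel]
  constructor <;> intro h <;> linear_combination h

theorem twistModel_Δ (d : ℤ) : (twistModel d).Δ = -1404928 * (d : ℚ) ^ 6 := by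
  simp only [twistModel, WeierstrassCurve.Δ, WeierstrassCurve.b₂, WeierstrassCurve.b₄,
    WeierstrassCurve.b₆, WeierstrassCurve.b₈]
  ring

theorem twist_ne_zero (d : ℤ) [hd : Fact (Squarefree d)] : (d : ℚ) ≠ 0 :=
  Int.cast_ne_zero.mpr hd.out.ne_zero

/-- For squarefree `d` the model is an elliptic curve, i.e. its discriminant is invertible. -/
instance twistModel_isElliptic (d : ℤ) [Fact (Squarefree d)] : (twistModel d).IsElliptic where
  isUnit := by
    rw [twistModel_Δ]
    exact (mul_ne_zero (by norm_num) (pow_ne_zero 6 (twist_ne_zero d))).isUnit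

/-- `E_d(ℚ)` for the curve `E_d : d y² = x³ - 35 x - 98`: the rational solutions together with the
unique point at infinity. -/
inductive TwistPoint (d : ℤ) : Type
  | infinity : TwistPoint d
  | affine (x y : ℚ) (h : (d : ℚ) * y ^ 2 = x ^ 3 - 35 * x - 98) : TwistPoint d

namespace TwistPoint

theorem equation_scale (d : ℤ) {x y : ℚ} (h : (d : ℚ) * y ^ 2 = x ^ 3 - 35 * x - 98) :
    (twistModel d).Equation (d * x) (d ^ 2 * y) := by
  rw [twistModel_equation_iff]
  linear_combination (d : ℚ) ^ 3 * h

theorem equation_unscale (d : ℤ) [Fact (Squarefree d)] {x y : ℚ}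
    (h : (twistModel d).Equation x y) :
    (d : ℚ) * (y / d ^ 2) ^ 2 = (x / d) ^ 3 - 35 * (x / d) - 98 := by
  rw [twistModel_equation_iff] at h
  have h0 := twist_ne_zero d
  field_simp
  linear_combination h

/-- The isomorphism `(x, y) ↦ (d x, d² y)` from `d y² = x³ - 35 x - 98` to the Weierstrass model
`y² = x³ - 35 d² x - 98 d³`, on rational points; the point at infinity goes to the point at
infinity. -/
def equivModel (d : ℤ) [Fact (Squarefree d)] : TwistPoint d ≃ (twistModel d).Point where
  toFun
    | infinity => .zero
    | affine _ _ h => .mk (equation_scale d h)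
  invFun
    | .zero => infinity
    | .some x y h => affine (x / d) (y / d ^ 2) (equation_unscale d h.1)
  left_inv := by
    have h0 := twist_ne_zero d
    rintro (_ | ⟨x, y, h⟩)
    · rfl
    · simp only [WeierstrassCurve.Affine.Point.mk, affine.injEq]
      constructor <;> field_simp
  right_inv := by
    have h0 := twist_ne_zero d
    rintro (_ | ⟨x, y, h⟩)
    · rfl
    · simp only [WeierstrassCurve.Affine.Point.mk, WeierstrassCurve.Affine.Point.some.injEq]
      constructor <;> field_simp

/-- The group law of `E_d(ℚ)` with the point at infinity as neutral element: the chord and tangent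
law of the Weierstrass model, carried over by the isomorphism `(x, y) ↦ (d x, d² y)`. -/
noncomputable instance (d : ℤ) [Fact (Squarefree d)] : AddCommGroup (TwistPoint d) :=
  (equivModel d).addCommGroup

/-- The isomorphism `(x, y) ↦ (d x, d² y)` as an isomorphism of groups. -/
noncomputable def addEquivModel (d : ℤ) [Fact (Squarefree d)] :
    TwistPoint d ≃+ (twistModel d).Point :=
  (equivModel d).addEquiv

end TwistPoint

/-- The rational point `(7 d, 0)` on the Weierstrass model `y² = x³ - 35 d² x - 98 d³`. -/
def twistGenerator (d : ℤ) [Fact (Squarefree d)] : (twistModel d).Point :=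
  WeierstrassCurve.Affine.Point.mk (x := 7 * (d : ℚ)) (y := 0) (by
    rw [twistModel_equation_iff]
    ring)

/-!
Put `t = x / d - 7`, so that the point `(7 d, 0)` has `t = 0`. In this coordinate doubling is given
by a rational function that does not depend on `d`,
`t ↦ (t² - 112)² / (4 t (t² + 21 t + 112))`,
defined whenever `t ≠ 0` since `t² + 21 t + 112` has negative discriminant. Moreover its value is
again nonzero since `112` is not a square. So a point other than `O` and `(7 d, 0)` can be doubled
forever without ever meeting these two points.

The whole argument is now `2`-adic. If `t` has negative `2`-adic valuation, doubling lowers the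
valuation by exactly two (`padicValRat_double_of_neg`); and from every `t ≠ 0` at most two
doublings reach a negative valuation (`exists_padicValRat_iterate_double_neg`). Hence the points
`2 ^ k • P` have infinitely many distinct coordinates and `P` is not torsion. This excludes torsion
of odd order and of order four simultaneously, for all twists.
-/

/-! ### Two-adic valuations of sums -/

theorem padicValRat_add_of_lt {p : ℕ} [Fact p.Prime] {x y : ℚ} (hx : x ≠ 0) (hy : y ≠ 0)
    (h : padicValRat p x < padicValRat p y) : padicValRat p (x + y) = padicValRat p x := by
  refine padicValRat.add_eq_of_lt (fun h0 => ?_) hx hy h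
  rw [eq_neg_of_add_eq_zero_left h0, padicValRat.neg] at h
  exact lt_irrefl _ h

/-- The residue field of `ℤ₂` has two elements, so two rationals of equal valuation have a sum of
larger valuation. -/
theorem padicValRat_two_lt_add {x y : ℚ} (hx : x ≠ 0) (hy : y ≠ 0) (hxy : x + y ≠ 0)
    (h : padicValRat 2 x = padicValRat 2 y) : padicValRat 2 x < padicValRat 2 (x + y) := by
  obtain ⟨r, rfl⟩ : ∃ r, x = r * y := ⟨x / y, by field_simp⟩
  have hr : r ≠ 0 := left_ne_zero_of_mul hx
  have hr1 : r + 1 ≠ 0 := by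
    rintro h0
    exact hxy (by linear_combination y * h0)
  have hv : padicValRat 2 r = 0 := by
    rw [padicValRat.mul hr hy] at h
    linarith
  have hden : ¬ 2 ∣ r.den := by
    intro hd
    have hn : ¬ 2 ∣ r.num.natAbs := fun hn => by
      have := Nat.dvd_gcd hn hd
      rw [r.reduced.gcd_eq_one] at this
      omega
    have h1 := one_le_padicValNat_of_dvd r.den_ne_zero hd
    rw [padicValRat_def, padicValInt, padicValNat.eq_zero_of_not_dvd hn] at hv
    omega
  have hnum : ¬ (2 : ℤ) ∣ r.num := by
    intro hn
    have h1 := one_le_padicValNat_of_dvd (p := 2) (n := r.num.natAbs)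
      (by simpa using hr) (by omega)
    rw [padicValRat_def, padicValInt, padicValNat.eq_zero_of_not_dvd hden] at hv
    omega
  have hsum : r + 1 = ((r.num + r.den : ℤ) : ℚ) / ((r.den : ℤ) : ℚ) := by
    have := r.den_ne_zero
    push_cast
    rw [add_div, div_self (by exact_mod_cast this), Rat.num_div_den]
  have hne : r.num + r.den ≠ 0 := fun h0 => hr1 (by rw [hsum, h0]; simp)
  have hv1 : 0 < padicValRat 2 (r + 1) := by
    rw [hsum, padicValRat.div (by exact_mod_cast hne) (by exact_mod_cast r.den_ne_zero),
      padicValRat.of_int, padicValRat.of_int, padicValInt, padicValInt, Int.natAbs_natCast,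
      padicValNat.eq_zero_of_not_dvd hden]
    have := one_le_padicValNat_of_dvd (p := 2) (n := (r.num + r.den).natAbs)
      (by omega) (by omega)
    omega
  rw [show r * y + y = (r + 1) * y by ring, padicValRat.mul hr1 hy, padicValRat.mul hr hy]
  linarith

/-! ### Doubling on the `t`-line -/

namespace TwistPoint

/-- The effect of doubling a point of `d y² = x³ - 35 x - 98` on the coordinate `t = x - 7`. -/
def double (t : ℚ) : ℚ := (t ^ 2 - 112) ^ 2 / (4 * t * (t ^ 2 + 21 * t + 112))

theorem padicValRat_two_112 : padicValRat 2 112 = 4 := by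
  have : padicValNat 2 (2 ^ 4 * 7) = 4 := by
    rw [padicValNat.mul (by norm_num) (by norm_num), padicValNat.prime_pow,
      padicValNat.eq_zero_of_not_dvd (by norm_num)]
  rw [show (112 : ℚ) = ((2 ^ 4 * 7 : ℕ) : ℚ) by norm_num, padicValRat.of_nat, this]
  rfl

theorem padicValRat_two_21_mul {t : ℚ} (ht : t ≠ 0) :
    padicValRat 2 (21 * t) = padicValRat 2 t := by
  rw [padicValRat.mul (by norm_num) ht, show (21 : ℚ) = ((21 : ℕ) : ℚ) by norm_num,
    padicValRat.of_nat, padicValNat.eq_zero_of_not_dvd (by norm_num)]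
  simp

theorem sq_sub_112_ne_zero (t : ℚ) : t ^ 2 - 112 ≠ 0 := by
  -- `112 = 7 * 16` has odd `7`-adic valuation.
  intro h
  have h7 : padicValNat 7 (7 ^ 1 * 16) = 1 := by
    have : Fact (Nat.Prime 7) := ⟨by norm_num⟩
    rw [padicValNat.mul (by norm_num) (by norm_num), padicValNat.prime_pow,
      padicValNat.eq_zero_of_not_dvd (by norm_num)]
  have : Fact (Nat.Prime 7) := ⟨by norm_num⟩
  have h2 : padicValRat 7 (t ^ 2) = 1 := by
    rw [show t ^ 2 = ((7 ^ 1 * 16 : ℕ) : ℚ) by norm_num; linarith, padicValRat.of_nat, h7]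
    rfl
  rw [padicValRat.pow] at h2
  push_cast at h2
  omega

theorem quadratic_factor_ne_zero (t : ℚ) : t ^ 2 + 21 * t + 112 ≠ 0 := by
  nlinarith [sq_nonneg (2 * t + 21)]

theorem double_ne_zero {t : ℚ} (ht : t ≠ 0) : double t ≠ 0 :=
  div_ne_zero (pow_ne_zero 2 (sq_sub_112_ne_zero t))
    (mul_ne_zero (mul_ne_zero four_ne_zero ht) (quadratic_factor_ne_zero t))

theorem padicValRat_double {t : ℚ} (ht : t ≠ 0) :
    padicValRat 2 (double t) = 2 * padicValRat 2 (t ^ 2 - 112) -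
      (2 + padicValRat 2 t + padicValRat 2 (t ^ 2 + 21 * t + 112)) := by
  have h4 : padicValRat 2 4 = 2 := by
    rw [show (4 : ℚ) = ((2 : ℕ) : ℚ) ^ 2 by norm_num, padicValRat.pow,
      padicValRat.self (by norm_num)]
    rfl
  have hq := quadratic_factor_ne_zero t
  have hn := sq_sub_112_ne_zero t
  rw [double, padicValRat.div (pow_ne_zero 2 hn) (by positivity), padicValRat.pow,
    padicValRat.mul (by positivity) hq, padicValRat.mul (by norm_num) ht, h4]
  rfl

theorem padicValRat_sq_two (t : ℚ) : padicValRat 2 (t ^ 2) = 2 * padicValRat 2 t := by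
  rw [padicValRat.pow]
  rfl

theorem padicValRat_sq_sub_112_of_lt {t : ℚ} (ht : t ≠ 0) (h : padicValRat 2 t < 2) :
    padicValRat 2 (t ^ 2 - 112) = 2 * padicValRat 2 t := by
  rw [sub_eq_add_neg, padicValRat_add_of_lt (by positivity) (by norm_num), padicValRat_sq_two]
  rw [padicValRat.neg, padicValRat_sq_two, padicValRat_two_112]
  linarith

theorem padicValRat_sq_sub_112_of_gt {t : ℚ} (ht : t ≠ 0) (h : 2 < padicValRat 2 t) :
    padicValRat 2 (t ^ 2 - 112) = 4 := by
  rw [sub_eq_neg_add, padicValRat_add_of_lt (by norm_num) (by positivity), padicValRat.neg,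
    padicValRat_two_112]
  rw [padicValRat.neg, padicValRat_sq_two, padicValRat_two_112]
  linarith

theorem padicValRat_linear_part {t : ℚ} (ht : t ≠ 0) (h : padicValRat 2 t < 4) :
    padicValRat 2 (21 * t + 112) = padicValRat 2 t ∧ 21 * t + 112 ≠ 0 := by
  have hlt : padicValRat 2 (21 * t) < padicValRat 2 112 := by
    rw [padicValRat_two_21_mul ht, padicValRat_two_112]
    exact h
  refine ⟨?_, fun h0 => ?_⟩
  · rw [padicValRat_add_of_lt (by positivity) (by norm_num) hlt, padicValRat_two_21_mul ht]
  · rw [eq_neg_of_add_eq_zero_left h0, padicValRat.neg] at hlt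
    exact lt_irrefl _ hlt

/-- For negative valuation `t ^ 2` dominates the quadratic factor. -/
theorem padicValRat_quadratic_factor_of_neg {t : ℚ} (ht : t ≠ 0) (h : padicValRat 2 t < 0) :
    padicValRat 2 (t ^ 2 + 21 * t + 112) = 2 * padicValRat 2 t := by
  obtain ⟨hl, hl0⟩ := padicValRat_linear_part ht (by linarith)
  rw [add_assoc, padicValRat_add_of_lt (by positivity) hl0, padicValRat_sq_two]
  rw [hl, padicValRat_sq_two]
  linarith

/-- For valuations from `1` to `3` the linear term `21 * t` dominates the quadratic factor. -/
theorem padicValRat_quadratic_factor_of_pos {t : ℚ} (ht : t ≠ 0) (h : 0 < padicValRat 2 t)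
    (h4 : padicValRat 2 t < 4) :
    padicValRat 2 (t ^ 2 + 21 * t + 112) = padicValRat 2 t := by
  obtain ⟨hl, hl0⟩ := padicValRat_linear_part ht h4
  rw [add_assoc, add_comm, padicValRat_add_of_lt hl0 (by positivity), hl]
  rw [hl, padicValRat_sq_two]
  linarith

theorem le_padicValRat_quadratic_factor {t : ℚ} (ht : t ≠ 0) (h : 0 ≤ padicValRat 2 t) :
    min (padicValRat 2 t) 4 ≤ padicValRat 2 (t ^ 2 + 21 * t + 112) := by
  have hq := quadratic_factor_ne_zero t
  have hq' : t * (t + 21) + 112 ≠ 0 := by convert hq using 1; ring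
  by_cases h21 : t + 21 = 0
  · rw [show t ^ 2 + 21 * t + 112 = 112 by linear_combination t * h21, padicValRat_two_112]
    exact min_le_right _ _
  · have h0 : 0 ≤ padicValRat 2 (t + 21) := by
      refine le_trans ?_ (padicValRat.min_le_padicValRat_add h21)
      exact le_min h (by
        rw [show (21 : ℚ) = ((21 : ℕ) : ℚ) by norm_num]
        exact zero_le_padicValRat_of_nat 21)
    have h1 := padicValRat.min_le_padicValRat_add (p := 2) hq'
    rw [padicValRat.mul ht h21, padicValRat_two_112] at h1
    rw [show t ^ 2 + 21 * t + 112 = t * (t + 21) + 112 by ring]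
    exact le_trans (min_le_min_right _ (by linarith)) h1

theorem padicValRat_double_of_neg {t : ℚ} (ht : t ≠ 0) (h : padicValRat 2 t < 0) :
    padicValRat 2 (double t) = padicValRat 2 t - 2 := by
  rw [padicValRat_double ht, padicValRat_sq_sub_112_of_lt ht (by linarith),
    padicValRat_quadratic_factor_of_neg ht h]
  ring

theorem padicValRat_double_neg_of_zero {t : ℚ} (ht : t ≠ 0) (h : padicValRat 2 t = 0) :
    padicValRat 2 (double t) < 0 := by
  have hq := le_padicValRat_quadratic_factor ht h.ge
  rw [padicValRat_double ht, padicValRat_sq_sub_112_of_lt ht (by linarith)]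
  rw [h] at hq ⊢
  norm_num at hq
  linarith

theorem padicValRat_double_neg_of_four_le {t : ℚ} (ht : t ≠ 0) (h : 4 ≤ padicValRat 2 t) :
    padicValRat 2 (double t) < 0 := by
  have hq := le_padicValRat_quadratic_factor ht (by linarith)
  rw [padicValRat_double ht, padicValRat_sq_sub_112_of_gt ht (by linarith)]
  rw [min_eq_right h] at hq
  linarith

theorem padicValRat_double_of_eq_one_or_three {t : ℚ} (ht : t ≠ 0)
    (h : padicValRat 2 t = 1 ∨ padicValRat 2 t = 3) : padicValRat 2 (double t) = 0 := by
  rcases h with h | h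
  · rw [padicValRat_double ht, padicValRat_sq_sub_112_of_lt ht (by linarith),
      padicValRat_quadratic_factor_of_pos ht (by linarith) (by linarith), h]
    norm_num
  · rw [padicValRat_double ht, padicValRat_sq_sub_112_of_gt ht (by linarith),
      padicValRat_quadratic_factor_of_pos ht (by linarith) (by linarith), h]
    norm_num

/-- Here `t ^ 2` and `112` have the same valuation `4`, and the cancellation in `t ^ 2 - 112` has to be
bounded by `padicValRat_two_lt_add`: the ultrametric inequality alone would allow valuation `2`
to be preserved. -/
theorem four_le_padicValRat_double {t : ℚ} (ht : t ≠ 0) (h : padicValRat 2 t = 2) :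
    4 ≤ padicValRat 2 (double t) := by
  have hn : padicValRat 2 (t ^ 2) < padicValRat 2 (t ^ 2 + -112) := by
    refine padicValRat_two_lt_add (by positivity) (by norm_num) ?_ ?_
    · rw [← sub_eq_add_neg]
      exact sq_sub_112_ne_zero t
    · rw [padicValRat.neg, padicValRat_sq_two, padicValRat_two_112, h]
      norm_num
  rw [padicValRat_sq_two, ← sub_eq_add_neg, h] at hn
  rw [padicValRat_double ht,
    padicValRat_quadratic_factor_of_pos ht (by linarith) (by linarith), h]
  omega

theorem iterate_double_ne_zero {t : ℚ} (ht : t ≠ 0) (k : ℕ) : double^[k] t ≠ 0 := by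
  induction k with
  | zero => exact ht
  | succ k ih =>
    rw [Function.iterate_succ_apply']
    exact double_ne_zero ih

/-- Valuations `1` and `3` double to `0`, valuation `2` doubles to at least `4`, and valuations `0`
and at least `4` double to negative ones. -/
theorem exists_padicValRat_iterate_double_neg {t : ℚ} (ht : t ≠ 0) :
    ∃ k, padicValRat 2 (double^[k] t) < 0 := by
  have h1 := double_ne_zero ht
  rcases lt_or_ge (padicValRat 2 t) 0 with h | h
  · exact ⟨0, h⟩
  rcases le_or_gt 4 (padicValRat 2 t) with h4 | h4
  · exact ⟨1, padicValRat_double_neg_of_four_le ht h4⟩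
  have hcases : padicValRat 2 t = 0 ∨ (padicValRat 2 t = 1 ∨ padicValRat 2 t = 3) ∨
      padicValRat 2 t = 2 := by omega
  rcases hcases with h | h | h
  · exact ⟨1, padicValRat_double_neg_of_zero ht h⟩
  · exact ⟨2, padicValRat_double_neg_of_zero h1 (padicValRat_double_of_eq_one_or_three ht h)⟩
  · exact ⟨2, padicValRat_double_neg_of_four_le h1 (four_le_padicValRat_double ht h)⟩

theorem padicValRat_iterate_double_of_neg {t : ℚ} (ht : t ≠ 0) (h : padicValRat 2 t < 0) (k : ℕ) :
    padicValRat 2 (double^[k] t) = padicValRat 2 t - 2 * k := by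
  induction k with
  | zero => simp
  | succ k ih =>
    rw [Function.iterate_succ_apply',
      padicValRat_double_of_neg (iterate_double_ne_zero ht k) (by rw [ih]; linarith), ih]
    push_cast
    ring

theorem injective_iterate_double_of_neg {t : ℚ} (ht : t ≠ 0) (h : padicValRat 2 t < 0) :
    Function.Injective fun k : ℕ => double^[k] t := by
  intro i j hij
  have := congrArg (padicValRat 2) hij
  simp only [padicValRat_iterate_double_of_neg ht h] at this
  omega

/-! ### Torsion points -/

variable {d : ℤ}

/-- The coordinate `t = x / d - 7` on the Weierstrass model. At infinity it takes the junk value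
`0`, so that `O` and `(7 d, 0)` are exactly the points with `t = 0`. -/
def tCoord : (twistModel d).Point → ℚ
  | .zero => 0
  | .some x _ _ => x / d - 7

theorem tCoord_some {x y : ℚ} (h : (twistModel d).Nonsingular x y) :
    tCoord (.some x y h) = x / d - 7 :=
  rfl

variable [Fact (Squarefree d)]

/-- The tangent formula in the coordinate `t`: the abscissa of the double of the point
`(d (t + 7), y)` is the square of the slope minus twice the abscissa. -/
theorem tangent_formula {d t y : ℚ} (hd : d ≠ 0) (ht : t ≠ 0)
    (h : y ^ 2 = d ^ 3 * (t * (t ^ 2 + 21 * t + 112))) :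
    (((3 * (d * (t + 7)) ^ 2 - 35 * d ^ 2) / (2 * y)) ^ 2 - 2 * (d * (t + 7))) / d - 7 =
      double t := by
  have hq := quadratic_factor_ne_zero t
  rw [div_pow _ (2 * y), mul_pow 2 y, h, double]
  -- `field_simp` would not see the quadratic factor as nonzero after expanding it.
  generalize hg : t ^ 2 + 21 * t + 112 = q at hq ⊢
  field_simp
  subst hg
  ring

theorem tCoord_add_self (P : (twistModel d).Point) (hP : tCoord P ≠ 0) :
    tCoord (P + P) = double (tCoord P) := by
  rcases P with _ | ⟨x, y, hxy⟩
  · exact absurd rfl hP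
  have hd := twist_ne_zero d
  have hx : d * (x / d - 7 + 7) = x := by field_simp; ring
  rw [tCoord_some] at hP ⊢
  have heq : y ^ 2 = (d : ℚ) ^ 3 *
      ((x / d - 7) * ((x / d - 7) ^ 2 + 21 * (x / d - 7) + 112)) := by
    rw [(twistModel_equation_iff d _ _).1 hxy.1]
    field_simp
    ring
  have hy : y ≠ 0 := by
    rintro rfl
    refine mul_ne_zero (pow_ne_zero 3 hd) (mul_ne_zero hP (quadratic_factor_ne_zero (x / d - 7))) ?_
    rw [← heq]
    ring
  have hneg : (twistModel d).negY x y = -y := by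
    simp [WeierstrassCurve.Affine.negY, twistModel]
  have hyn : y ≠ (twistModel d).negY x y := by
    rw [hneg]
    intro h
    exact hy (by linarith)
  have hadd : (twistModel d).addX x x ((twistModel d).slope x x y y) =
      ((3 * x ^ 2 - 35 * d ^ 2) / (2 * y)) ^ 2 - 2 * x := by
    rw [WeierstrassCurve.Affine.slope_of_Y_ne rfl hyn, hneg]
    simp only [WeierstrassCurve.Affine.addX, twistModel]
    ring_nf
  rw [WeierstrassCurve.Affine.Point.add_self_of_Y_ne hyn, tCoord_some, hadd,
    ← tangent_formula hd hP heq, hx]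

theorem tCoord_two_pow_nsmul (P : (twistModel d).Point) (hP : tCoord P ≠ 0) (k : ℕ) :
    tCoord (2 ^ k • P) = double^[k] (tCoord P) := by
  induction k with
  | zero => simp
  | succ k ih =>
    rw [pow_succ, mul_nsmul, two_nsmul, ← nsmul_add, Function.iterate_succ_apply', ← ih,
      nsmul_add, tCoord_add_self]
    rw [ih]
    exact iterate_double_ne_zero hP k

/-- From some point on the multiples `2 ^ k • P` are pairwise distinct. -/
theorem not_isOfFinAddOrder_of_tCoord_ne_zero {P : (twistModel d).Point} (hP : tCoord P ≠ 0) :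
    ¬ IsOfFinAddOrder P := by
  intro hfin
  obtain ⟨m, hm⟩ := exists_padicValRat_iterate_double_neg hP
  have hinj := injective_iterate_double_of_neg (iterate_double_ne_zero hP m) hm
  have hmaps : ∀ k : ℕ, 2 ^ (k + m) • P ∈ (AddSubmonoid.multiples P : Set (twistModel d).Point) :=
    fun k => ⟨2 ^ (k + m), rfl⟩
  have hfinite : (AddSubmonoid.multiples P : Set (twistModel d).Point).Finite :=
    finite_multiples.2 hfin
  refine Set.infinite_of_injective_forall_mem (fun i j hij => hinj ?_) hmaps hfinite
  have := congrArg tCoord hij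
  simpa only [tCoord_two_pow_nsmul P hP, Function.iterate_add_apply] using this

theorem twistGenerator_ne_zero : twistGenerator d ≠ 0 :=
  WeierstrassCurve.Affine.Point.some_ne_zero _

theorem addOrderOf_twistGenerator : addOrderOf (twistGenerator d) = 2 := by
  refine addOrderOf_eq_prime ?_ twistGenerator_ne_zero
  rw [two_nsmul]
  exact WeierstrassCurve.Affine.Point.add_self_of_Y_eq
    (by simp [WeierstrassCurve.Affine.negY, twistModel])

theorem eq_zero_or_eq_twistGenerator {P : (twistModel d).Point} (hP : tCoord P = 0) :
    P = 0 ∨ P = twistGenerator d := by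
  rcases P with _ | ⟨x, y, hxy⟩
  · exact Or.inl rfl
  right
  have hd := twist_ne_zero d
  have hx : x = 7 * d := by
    simp only [tCoord] at hP
    field_simp at hP
    linarith
  subst hx
  have hy : y ^ 2 = 0 := by
    rw [(twistModel_equation_iff d _ _).1 hxy.1]
    ring
  obtain rfl : y = 0 := by simpa using hy
  rfl

variable (d) in
theorem torsion_eq_zmultiples_twistGenerator :
    AddCommGroup.torsion (twistModel d).Point = AddSubgroup.zmultiples (twistGenerator d) := by
  apply le_antisymm
  · intro P hP
    have h0 : tCoord P = 0 := by
      by_contra h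
      exact not_isOfFinAddOrder_of_tCoord_ne_zero h hP
    rcases eq_zero_or_eq_twistGenerator h0 with rfl | rfl
    · exact zero_mem _
    · exact AddSubgroup.mem_zmultiples _
  · rw [AddSubgroup.zmultiples_le]
    exact addOrderOf_pos_iff.1 (by rw [addOrderOf_twistGenerator]; norm_num)

end TwistPoint

theorem nonempty_zmultiples_addEquiv_zmod {G : Type*} [AddGroup G] {g : G} {n : ℕ}
    (hg : addOrderOf g = n) : Nonempty (AddSubgroup.zmultiples g ≃+ ZMod n) := by
  rw [← hg, ← Nat.card_zmultiples]
  exact ⟨(zmodAddCyclicAddEquiv inferInstance).symm⟩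

theorem AddEquiv.torsion_eq_zmultiples_symm {G H : Type*} [AddCommGroup G] [AddCommGroup H]
    (e : G ≃+ H) {h : H} (hh : AddCommGroup.torsion H = AddSubgroup.zmultiples h) :
    AddCommGroup.torsion G = AddSubgroup.zmultiples (e.symm h) := by
  ext g
  have h1 : g ∈ AddCommGroup.torsion G ↔ e g ∈ AddCommGroup.torsion H :=
    (e.injective.isOfFinAddOrder_iff (f := e.toAddMonoidHom)).symm
  rw [h1, hh, AddSubgroup.mem_zmultiples_iff, AddSubgroup.mem_zmultiples_iff]
  simp only [← map_zsmul, AddEquiv.symm_apply_eq]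

theorem lemmaA1 (d : ℤ) [Fact (Squarefree d)] :
    Nonempty (AddCommGroup.torsion (TwistPoint d) ≃+ ZMod 2) ∧
      AddCommGroup.torsion (TwistPoint d) =
        AddSubgroup.zmultiples ((TwistPoint.addEquivModel d).symm (twistGenerator d)) ∧
      Nonempty (AddCommGroup.torsion (twistModel d).Point ≃+ ZMod 2) ∧
      AddCommGroup.torsion (twistModel d).Point = AddSubgroup.zmultiples (twistGenerator d) := by
  have hM := TwistPoint.torsion_eq_zmultiples_twistGenerator d
  have hT := (TwistPoint.addEquivModel d).torsion_eq_zmultiples_symm hM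
  refine ⟨?_, hT, ?_, hM⟩
  · rw [hT]
    exact nonempty_zmultiples_addEquiv_zmod
      ((AddEquiv.addOrderOf_eq _ _).trans TwistPoint.addOrderOf_twistGenerator)
  · rw [hM]
    exact nonempty_zmultiples_addEquiv_zmod TwistPoint.addOrderOf_twistGenerator
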